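/- Let $\mathbb{k}$ be a field of characteristic $0$, let $L$ be the free Lie algebra over $\mathbb{k}$ on two generators $x, y$, and let $F_n L$, $n\geq 1$, be the spans of all iterated brackets of at least $n$ generators (the lower central series of $L$). Let $\widehat{L}=\varprojlim_n L/F_nL$ be the free complete Lie algebra on $x, y$, with the inverse limit topology of the discrete quotients $L/F_nL$. (A shifted Lie algebra concentrated in degree $1$ is the same thing as an ordinary Lie algebra, and $\widehat{L}$ is the free complete shifted Lie algebra $\widehat{s\mathrm{Lie}}(x,y)$ on two generators of degree $1$.) For $a\in\widehat{L}$, let $e^{\mathrm{ad}_a}\colon\widehat{L}\to\widehat{L}$ be the operator $u\mapsto\sum_{n\geq 0}\frac{1}{n!}\,\mathrm{ad}_a^n(u)$, where $\mathrm{ad}_a(u)=[a,u]$; this series converges. Then there exists a unique element $\mathrm{BCH}(x,y)\in\widehat{L}$ such that $$e^{\mathrm{ad}_{\mathrm{BCH}(x,y)}} = e^{\mathrm{ad}_x}\circ e^{\mathrm{ad}_y}\ .$$ -/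

import Mathlib

/-- The weight filtration of the free Lie algebra on `X`: the `n`-th term of the lower central
series (indexed from `0`), which is spanned by the iterated brackets of at least `n + 1`
generators. -/
noncomputable abbrev FreeLieAlgebra.weightFiltration (K X : Type*) [CommRing K] (n : ℕ) :
    LieIdeal K (FreeLieAlgebra K X) :=
  LieModule.lowerCentralSeries K (FreeLieAlgebra K X) (FreeLieAlgebra K X) n

theorem FreeLieAlgebra.weightFiltration_antitone (K X : Type*) [CommRing K] :
    Antitone (FreeLieAlgebra.weightFiltration K X) :=
  LieModule.antitone_lowerCentralSeries K (FreeLieAlgebra K X) (FreeLieAlgebra K X)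

theorem FreeLieAlgebra.weightFiltration_le (K X : Type*) [CommRing K] {m n : ℕ} (h : m ≤ n) :
    (FreeLieAlgebra.weightFiltration K X n).toSubmodule ≤
      (FreeLieAlgebra.weightFiltration K X m).toSubmodule :=
  FreeLieAlgebra.weightFiltration_antitone K X h

/-- The free complete Lie algebra on `X`: the inverse limit of the quotients of the free Lie algebra
by its weight filtration, as a subspace of their product. -/
noncomputable def FreeCompleteLieAlgebra (K X : Type*) [CommRing K] :
    Submodule K
      ((n : ℕ) → FreeLieAlgebra K X ⧸ FreeLieAlgebra.weightFiltration K X n) where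
  carrier := {f | ∀ (m n : ℕ) (h : m ≤ n),
    Submodule.factor (FreeLieAlgebra.weightFiltration_le K X h) (f n) = f m}
  add_mem' := by
    intro f g hf hg m n h
    change _ = f m + g m
    rw [← hf m n h, ← hg m n h]
    exact map_add _ _ _
  zero_mem' := by
    intro m n h
    exact map_zero _
  smul_mem' := by
    intro c f hf m n h
    change _ = c • f m
    rw [← hf m n h]
    exact LinearMap.map_smul _ c (f n)

namespace FreeCompleteLieAlgebra

variable (K X : Type*)

section

variable [CommRing K]

/-- The Lie bracket of the inverse limit is computed in each of the quotients. -/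
noncomputable instance : Bracket (FreeCompleteLieAlgebra K X) (FreeCompleteLieAlgebra K X) where
  bracket f g := ⟨fun n => ⁅f.1 n, g.1 n⁆, by
    intro m n h
    have h1 := f.2 m n h
    have h2 := g.2 m n h
    obtain ⟨a, ha⟩ := Submodule.Quotient.mk_surjective _ (f.1 n)
    obtain ⟨b, hb⟩ := Submodule.Quotient.mk_surjective _ (g.1 n)
    rw [← ha] at h1
    rw [← hb] at h2
    change Submodule.factor _ ⁅f.1 n, g.1 n⁆ = ⁅f.1 m, g.1 m⁆
    rw [← ha, ← hb, ← h1, ← h2]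
    rfl⟩

noncomputable instance : LieRing (FreeCompleteLieAlgebra K X) where
  add_lie f g h := Subtype.ext (funext fun n => add_lie (f.1 n) (g.1 n) (h.1 n))
  lie_add f g h := Subtype.ext (funext fun n => lie_add (f.1 n) (g.1 n) (h.1 n))
  lie_self f := Subtype.ext (funext fun n => lie_self (f.1 n))
  leibniz_lie f g h := Subtype.ext (funext fun n => leibniz_lie (f.1 n) (g.1 n) (h.1 n))

noncomputable instance : LieAlgebra K (FreeCompleteLieAlgebra K X) where
  lie_smul c f g := Subtype.ext (funext fun n => lie_smul c (f.1 n) (g.1 n))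

/-- The topology of the inverse limit: the coarsest one for which all the projections to the
quotients of the free Lie algebra, with their discrete topologies, are continuous. -/
instance : TopologicalSpace (FreeCompleteLieAlgebra K X) :=
  ⨅ n : ℕ, TopologicalSpace.induced
    (fun f : FreeCompleteLieAlgebra K X => f.1 n) (⊥ : TopologicalSpace _)

variable {X}

/-- The generators of the free complete Lie algebra. -/
noncomputable def of (i : X) : FreeCompleteLieAlgebra K X :=
  ⟨fun _ => LieSubmodule.Quotient.mk (FreeLieAlgebra.of K i), fun _ _ _ => rfl⟩

variable {K}

theorem tendsto_iff {ι : Type*} {l : Filter ι} {F : ι → FreeCompleteLieAlgebra K X}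
    {f : FreeCompleteLieAlgebra K X} :
    Filter.Tendsto F l (nhds f) ↔ ∀ n, ∀ᶠ i in l, (F i).1 n = f.1 n := by
  rw [nhds_iInf, Filter.tendsto_iInf]
  refine forall_congr' fun n => ?_
  let _ : TopologicalSpace (FreeLieAlgebra K X ⧸ FreeLieAlgebra.weightFiltration K X n) := ⊥
  have : DiscreteTopology (FreeLieAlgebra K X ⧸ FreeLieAlgebra.weightFiltration K X n) := ⟨rfl⟩
  rw [nhds_induced, Filter.tendsto_comap_iff, nhds_discrete, Filter.tendsto_pure]
  rfl

instance : T2Space (FreeCompleteLieAlgebra K X) := by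
  rw [t2Space_iff_nhds]
  intro f g hfg
  obtain ⟨n, hn⟩ : ∃ n, f.1 n ≠ g.1 n := by
    by_contra! h
    exact hfg (Subtype.ext (funext h))
  have hf := tendsto_iff.1 (Filter.tendsto_id (x := nhds f)) n
  have hg := tendsto_iff.1 (Filter.tendsto_id (x := nhds g)) n
  refine ⟨_, hf, _, hg, Set.disjoint_left.2 fun h h1 h2 => hn ?_⟩
  exact h1.symm.trans h2

theorem ad_pow_apply_eq_zero (a u : FreeCompleteLieAlgebra K X) {n k : ℕ} (h : n ≤ k) :
    ((LieAlgebra.ad K (FreeCompleteLieAlgebra K X) a ^ k) u).1 n = 0 := by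
  obtain ⟨a', ha⟩ := Submodule.Quotient.mk_surjective _ (a.1 n)
  obtain ⟨u', hu⟩ := Submodule.Quotient.mk_surjective _ (u.1 n)
  have key : ∀ j : ℕ, ((LieAlgebra.ad K (FreeCompleteLieAlgebra K X) a ^ j) u).1 n =
      LieSubmodule.Quotient.mk ((LieAlgebra.ad K (FreeLieAlgebra K X) a' ^ j) u') := by
    intro j
    induction j with
    | zero => exact hu.symm
    | succ j ih =>
      rw [pow_succ', pow_succ', Module.End.mul_apply, Module.End.mul_apply]
      change ⁅a.1 n, ((LieAlgebra.ad K (FreeCompleteLieAlgebra K X) a ^ j) u).1 n⁆ = _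
      rw [ih, ← ha]
      rfl
  rw [key]
  refine (LieSubmodule.Quotient.mk_eq_zero _).2 ?_
  refine FreeLieAlgebra.weightFiltration_antitone K X h ?_
  have := LieModule.iterate_toEnd_mem_lowerCentralSeries K (FreeLieAlgebra K X)
    (FreeLieAlgebra K X) a' u' k
  rw [← Module.End.pow_apply] at this
  exact this

end

variable {K X} [Field K]

/-- The operator `e^{ad_a} = ∑ₙ (ad_a)ⁿ / n!` on the free complete Lie algebra, the series being
summed in the topology of the inverse limit. -/
noncomputable def expAd (a u : FreeCompleteLieAlgebra K X) : FreeCompleteLieAlgebra K X :=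
  ∑' k : ℕ, ((k.factorial : K)⁻¹) • (LieAlgebra.ad K (FreeCompleteLieAlgebra K X) a ^ k) u

/-- The series which defines `expAd` converges. -/
theorem hasSum_expAd (a u : FreeCompleteLieAlgebra K X) :
    HasSum (fun k : ℕ =>
      ((k.factorial : K)⁻¹) • (LieAlgebra.ad K (FreeCompleteLieAlgebra K X) a ^ k) u)
      (expAd a u) := by
  refine Summable.hasSum ?_
  set F : ℕ → FreeCompleteLieAlgebra K X := fun k =>
    ((k.factorial : K)⁻¹) • (LieAlgebra.ad K (FreeCompleteLieAlgebra K X) a ^ k) u with hF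
  have hzero : ∀ n k, n ≤ k → (F k).1 n = 0 := by
    intro n k h
    change ((k.factorial : K)⁻¹) •
      ((LieAlgebra.ad K (FreeCompleteLieAlgebra K X) a ^ k) u).1 n = 0
    rw [ad_pow_apply_eq_zero a u h, smul_zero]
  have hev : ∀ n (s : Finset ℕ), Finset.range n ⊆ s →
      (∑ k ∈ s, F k).1 n = (∑ k ∈ Finset.range n, F k).1 n := by
    intro n s hs
    rw [← Finset.sum_sdiff hs]
    change (∑ k ∈ s \ Finset.range n, F k).1 n + (∑ k ∈ Finset.range n, F k).1 n = _
    have : (∑ k ∈ s \ Finset.range n, F k).1 n = 0 := by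
      have : ∀ t : Finset ℕ, (∀ k ∈ t, n ≤ k) → (∑ k ∈ t, F k).1 n = 0 := by
        intro t
        induction t using Finset.induction_on with
        | empty => intro _; rfl
        | insert i t hi ih =>
          intro ht
          rw [Finset.sum_insert hi]
          change (F i).1 n + (∑ k ∈ t, F k).1 n = 0
          rw [ih fun k hk => ht k (Finset.mem_insert_of_mem hk),
            hzero n i (ht i (Finset.mem_insert_self i t)), add_zero]
      refine this _ fun k hk => ?_
      simpa using (Finset.mem_sdiff.1 hk).2
    rw [this, zero_add]
  refine ⟨⟨fun n => (∑ k ∈ Finset.range n, F k).1 n, ?_⟩, ?_⟩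
  · intro m n h
    change _ = (∑ k ∈ Finset.range m, F k).1 m
    rw [← hev m (Finset.range n) (Finset.range_mono h)]
    exact (∑ k ∈ Finset.range n, F k).2 m n h
  · refine tendsto_iff.2 fun n => ?_
    simp only [SummationFilter.unconditional_filter]
    filter_upwards [Filter.eventually_ge_atTop (Finset.range n)] with s hs
    exact hev n s hs

end FreeCompleteLieAlgebra

/-! Existence is solved in each nilpotent quotient `Q` of the free Lie algebra by a differential
equation, with the degree derivation `E` (multiplication by `n` on brackets of `n` generators) in
the role of `d/dt`. Conjugating `E` by an exponential gives `[E, e^{ad_b}] = ad_{D(b)} e^{ad_b}`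
with `D(b) = ((e^{ad_b} - 1)/ad_b)(E b)`. Since `E x = x` and `E y = y`, the product `e^{ad_x}
e^{ad_y}` satisfies the same equation with `c = x + e^{ad_x} y` in place of `D(b)`. To leading order
`D` multiplies differences in weight `n` by `n`, so in characteristic `0` it is bijective and `D(b)
= c` has a unique solution. Two solutions of `[E, φ] = ad_c φ` that are the identity to leading
order coincide, which is the required identity; uniqueness of `b` makes the solutions compatible, so
they define an element of the limit.

For uniqueness, the leading term of `e^{ad_b} - e^{ad_b'}` is `ad_{b - b'}`, so it suffices that a
nonzero leading term cannot commute with every generator (`mem_weightFiltration_succ`). This is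
checked on words in the free associative algebra and brought back by the Dynkin map, which recovers
a Lie element up to the factor given by its degree. -/

open Finset

/-- The exponential series of `a`, truncated after `N` terms. -/
noncomputable def truncatedExp (K : Type*) {A : Type*} [Field K] [Ring A] [Algebra K A] (N : ℕ)
    (a : A) : A :=
  ∑ k ∈ range N, ((k.factorial : K)⁻¹) • a ^ k

/-! ### Conjugation by the exponential of a nilpotent element. -/

section AssociativeAlgebra

variable {K A : Type*} [Field K] [CharZero K] [Ring A] [Algebra K A]

omit [CharZero K] in
theorem truncatedExp_eq_exp [Module ℚ A] {a : A} {N : ℕ} (ha : a ^ N = 0) :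
    truncatedExp K N a = IsNilpotent.exp a := by
  rw [IsNilpotent.exp_eq_sum ha, truncatedExp]
  exact sum_congr rfl fun k _ => inv_natCast_smul_eq K ℚ _ _

/-- The identity `e^a T e^{-a} = e^{ad_a} T` for a nilpotent element `a`, the iterated commutators
`(ad_a)^k T` being given as a sequence. -/
theorem truncatedExp_mul {a : A} {N M : ℕ} (ha : a ^ N = 0) (T : ℕ → A)
    (hT : ∀ k, T (k + 1) = a * T k - T k * a) (hM : T M = 0) :
    truncatedExp K N a * T 0 =
      (∑ k ∈ range M, ((k.factorial : K)⁻¹) • T k) * truncatedExp K N a := by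
  let _ : Module ℚ A := Module.compHom A (algebraMap ℚ K)
  set l : Module.End K A := LinearMap.mulLeft K a
  set r : Module.End K A := LinearMap.mulRight K a
  have hl : l ^ N = 0 := by rw [LinearMap.pow_mulLeft, ha, LinearMap.mulLeft_zero_eq_zero]
  have hr : r ^ N = 0 := by rw [LinearMap.pow_mulRight, ha, LinearMap.mulRight_zero_eq_zero]
  have hlr : Commute l r := LinearMap.commute_mulLeft_right a a
  have hd : IsNilpotent (l - r) := hlr.isNilpotent_sub ⟨N, hl⟩ ⟨N, hr⟩
  have hTk : ∀ k, ((l - r) ^ k) (T 0) = T k := by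
    intro k
    induction k with
    | zero => rfl
    | succ k ih => rw [pow_succ', Module.End.mul_apply, ih, hT]; rfl
  have hexpd : IsNilpotent.exp (l - r) (T 0) = ∑ k ∈ range M, ((k.factorial : K)⁻¹) • T k := by
    have := IsNilpotent.exp_smul_eq_sum (a := l - r) (m := T 0) (k := M)
      (by rw [Module.End.smul_def, hTk, hM]) hd
    rw [Module.End.smul_def] at this
    rw [this]
    refine sum_congr rfl fun k _ => ?_
    rw [Module.End.smul_def, hTk, inv_natCast_smul_eq K ℚ]
  have hexpl : IsNilpotent.exp l (T 0) = truncatedExp K N a * T 0 := by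
    rw [← truncatedExp_eq_exp (K := K) hl, truncatedExp, truncatedExp, sum_mul,
      LinearMap.sum_apply]
    refine sum_congr rfl fun k _ => ?_
    rw [LinearMap.smul_apply, LinearMap.pow_mulLeft, LinearMap.mulLeft_apply, smul_mul_assoc]
  have hexpr : ∀ u, IsNilpotent.exp r u = u * truncatedExp K N a := by
    intro u
    rw [← truncatedExp_eq_exp (K := K) hr, truncatedExp, truncatedExp, mul_sum,
      LinearMap.sum_apply]
    refine sum_congr rfl fun k _ => ?_
    rw [LinearMap.smul_apply, LinearMap.pow_mulRight, LinearMap.mulRight_apply, mul_smul_comm]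
  -- Left multiplication is `l = r + (l - r)` with commuting summands, so `exp l = exp r * exp (l -
  -- r)`; evaluating at `T 0` is the claim.
  have hcomm : Commute r (l - r) := hlr.symm.sub_right (Commute.refl r)
  have := IsNilpotent.exp_add_of_commute hcomm ⟨N, hr⟩ hd
  rw [add_sub_cancel] at this
  rw [← hexpl, this, Module.End.mul_apply, hexpr, hexpd]

end AssociativeAlgebra

open LieModule (lowerCentralSeries)

/-! ### The lower central series as a filtration. -/

section LowerCentralSeries

variable {K Q : Type*} [CommRing K] [LieRing Q] [LieAlgebra K Q]

theorem lowerCentralSeries_succ_induction {m : ℕ} {p : Q → Prop} (zero : p 0)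
    (add : ∀ u v, p u → p v → p (u + v)) (smul : ∀ (c : K) u, p u → p (c • u))
    (lie : ∀ a : Q, ∀ u ∈ lowerCentralSeries K Q Q m, p ⁅a, u⁆) {u : Q}
    (hu : u ∈ lowerCentralSeries K Q Q (m + 1)) : p u := by
  rw [LieModule.lowerCentralSeries_succ, ← LieSubmodule.mem_toSubmodule,
    LieSubmodule.lieIdeal_oper_eq_linear_span'] at hu
  refine Submodule.span_induction ?_ zero (fun u v _ _ => add u v) (fun c u _ => smul c u) hu
  rintro _ ⟨a, -, v, hv, rfl⟩
  exact lie a v hv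

theorem lie_mem_lowerCentralSeries_succ (a : Q) {m : ℕ} {u : Q}
    (hu : u ∈ lowerCentralSeries K Q Q m) : ⁅a, u⁆ ∈ lowerCentralSeries K Q Q (m + 1) := by
  rw [LieModule.lowerCentralSeries_succ]
  exact LieSubmodule.lie_mem_lie (LieSubmodule.mem_top a) hu

/-- Index `m` means weight `m + 1`, so additivity of weights produces the extra `1`. The induction
is the Jacobi identity. -/
theorem lie_mem_lowerCentralSeries {m n : ℕ} {u v : Q} (hu : u ∈ lowerCentralSeries K Q Q m)
    (hv : v ∈ lowerCentralSeries K Q Q n) : ⁅u, v⁆ ∈ lowerCentralSeries K Q Q (m + n + 1) := by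
  induction m generalizing n u v with
  | zero => rw [zero_add]; exact lie_mem_lowerCentralSeries_succ u hv
  | succ m ih =>
    refine lowerCentralSeries_succ_induction (p := fun u => ⁅u, v⁆ ∈ lowerCentralSeries K Q Q _)
      ?_ ?_ ?_ ?_ hu
    · rw [zero_lie]; exact zero_mem _
    · intro u u' h h'; rw [add_lie]; exact add_mem h h'
    · intro c u h; rw [smul_lie]; exact SMulMemClass.smul_mem c h
    · intro a u hu
      rw [lie_lie]
      refine sub_mem ?_ ?_
      · rw [show m + 1 + n + 1 = (m + n + 1) + 1 by ring]
        exact lie_mem_lowerCentralSeries_succ a (ih hu hv)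
      · rw [show m + 1 + n + 1 = m + (n + 1) + 1 by ring]
        exact ih hu (lie_mem_lowerCentralSeries_succ a hv)

theorem ad_pow_mem_lowerCentralSeries (b : Q) {j : ℕ} {u : Q}
    (hu : u ∈ lowerCentralSeries K Q Q j) (k : ℕ) :
    (LieAlgebra.ad K Q b ^ k) u ∈ lowerCentralSeries K Q Q (j + k) := by
  induction k with
  | zero => exact hu
  | succ k ih =>
    rw [pow_succ', Module.End.mul_apply]
    exact lie_mem_lowerCentralSeries_succ b ih

theorem ad_pow_sub_ad_pow_mem_lowerCentralSeries {b b' : Q} {m : ℕ}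
    (h : b - b' ∈ lowerCentralSeries K Q Q m) (u : Q) (k : ℕ) :
    (LieAlgebra.ad K Q b ^ k) u - (LieAlgebra.ad K Q b' ^ k) u ∈
      lowerCentralSeries K Q Q (m + k) := by
  induction k with
  | zero => simp
  | succ k ih =>
    have : (LieAlgebra.ad K Q b ^ (k + 1)) u - (LieAlgebra.ad K Q b' ^ (k + 1)) u =
        ⁅b, (LieAlgebra.ad K Q b ^ k) u - (LieAlgebra.ad K Q b' ^ k) u⁆ +
          ⁅b - b', (LieAlgebra.ad K Q b' ^ k) u⁆ := by
      rw [pow_succ', pow_succ', Module.End.mul_apply, Module.End.mul_apply]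
      simp
    rw [this]
    refine add_mem (lie_mem_lowerCentralSeries_succ b ih) (lie_mem_lowerCentralSeries h ?_)
    have := ad_pow_mem_lowerCentralSeries (K := K) b' (j := 0) (u := u) (by simp) k
    rwa [zero_add] at this

theorem ad_pow_eq_zero_of_lowerCentralSeries_eq_bot {N : ℕ}
    (hN : lowerCentralSeries K Q Q N = ⊥) (b : Q) : LieAlgebra.ad K Q b ^ N = 0 := by
  ext u
  have := ad_pow_mem_lowerCentralSeries (K := K) b (j := 0) (u := u) (by simp) N
  rwa [zero_add, hN, LieSubmodule.mem_bot] at this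

end LowerCentralSeries

/-! ### Degree derivations. -/

/-- A derivation which is congruent to the identity modulo the commutator ideal; it acts on the
`n`-th graded piece of the lower central series as multiplication by `n`. -/
structure IsDegreeDerivation {K Q : Type*} [CommRing K] [LieRing Q] [LieAlgebra K Q]
    (E : Q →ₗ[K] Q) : Prop where
  map_lie : ∀ u v, E ⁅u, v⁆ = ⁅E u, v⁆ + ⁅u, E v⁆
  map_sub_self_mem : ∀ u, E u - u ∈ lowerCentralSeries K Q Q 1

namespace IsDegreeDerivation

section CommRing

variable {K Q : Type*} [CommRing K] [LieRing Q] [LieAlgebra K Q] {E : Q →ₗ[K] Q}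
  (hE : IsDegreeDerivation E)

include hE

theorem sub_smul_mem {n : ℕ} {u : Q} (hu : u ∈ lowerCentralSeries K Q Q n) :
    E u - ((n : K) + 1) • u ∈ lowerCentralSeries K Q Q (n + 1) := by
  induction n generalizing u with
  | zero => simpa using hE.map_sub_self_mem u
  | succ n ih =>
    refine lowerCentralSeries_succ_induction
      (p := fun u => E u - (((n + 1 : ℕ) : K) + 1) • u ∈ lowerCentralSeries K Q Q (n + 1 + 1))
      (by simp) ?_ ?_ ?_ hu
    · intro u v h h'
      rw [map_add, smul_add, add_sub_add_comm]
      exact add_mem h h'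
    · intro c u h
      rw [map_smul, smul_comm, ← smul_sub]
      exact SMulMemClass.smul_mem c h
    · intro a u hu
      have : E ⁅a, u⁆ - (((n + 1 : ℕ) : K) + 1) • ⁅a, u⁆ =
          ⁅E a - a, u⁆ + ⁅a, E u - ((n : K) + 1) • u⁆ := by
        rw [hE.map_lie, sub_lie, lie_sub, lie_smul]
        push_cast
        module
      rw [this]
      refine add_mem ?_ (lie_mem_lowerCentralSeries_succ a (ih hu))
      have := lie_mem_lowerCentralSeries (hE.map_sub_self_mem a) hu
      rwa [show 1 + n + 1 = n + 1 + 1 by ring] at this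

theorem mul_ad (b : Q) :
    E * LieAlgebra.ad K Q b = LieAlgebra.ad K Q b * E + LieAlgebra.ad K Q (E b) := by
  ext u
  simp [hE.map_lie, add_comm]

end CommRing

end IsDegreeDerivation

/-! ### The differential equation of the exponential in a nilpotent Lie algebra. -/

/-- The series `((e^{ad_b} - 1) / ad_b) (E b)`, truncated after `N` terms. -/
noncomputable def truncatedDexp {K Q : Type*} [Field K] [LieRing Q] [LieAlgebra K Q] (N : ℕ)
    (E : Q →ₗ[K] Q) (b : Q) : Q :=
  ∑ k ∈ range N, (((k + 1).factorial : K)⁻¹) • (LieAlgebra.ad K Q b ^ k) (E b)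

namespace IsDegreeDerivation

variable {K Q : Type*} [Field K] [CharZero K] [LieRing Q] [LieAlgebra K Q] {E : Q →ₗ[K] Q}
  (hE : IsDegreeDerivation E) {N : ℕ}

include hE

/-- The derivative of the exponential. -/
theorem mul_truncatedExp_ad (hN : lowerCentralSeries K Q Q N = ⊥) (b : Q) :
    E * truncatedExp K N (LieAlgebra.ad K Q b) =
      truncatedExp K N (LieAlgebra.ad K Q b) * E +
        LieAlgebra.ad K Q (truncatedDexp N E b) * truncatedExp K N (LieAlgebra.ad K Q b) := by
  set a := LieAlgebra.ad K Q b with ha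
  -- These are the iterated commutators of `ad_b` with `E`: the first is `-ad (E b)` because `E` is
  -- a derivation. The initial `E` shifts the index, which turns `1/k!` into the `1/(k+1)!` of
  -- `truncatedDexp`.
  let T : ℕ → Module.End K Q := fun k =>
    Nat.casesOn k E fun k => -LieAlgebra.ad K Q ((a ^ k) (E b))
  have key := truncatedExp_mul (K := K) (M := N + 1)
    (ad_pow_eq_zero_of_lowerCentralSeries_eq_bot hN b) T ?_ ?_
  · rw [sum_range_succ'] at key
    have hsum : ∑ k ∈ range N, (((k + 1).factorial : K)⁻¹) • T (k + 1) =
        -LieAlgebra.ad K Q (truncatedDexp N E b) := by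
      rw [truncatedDexp, map_sum, ← sum_neg_distrib]
      refine sum_congr rfl fun k _ => ?_
      rw [map_smul, ← smul_neg]
    rw [hsum] at key
    have h0 : T 0 = E := rfl
    rw [h0] at key
    rw [← ha] at key
    rw [key]
    simp [add_mul]
  · intro k
    cases k with
    | zero =>
      change -LieAlgebra.ad K Q (E b) = a * E - E * a
      rw [ha, hE.mul_ad]
      abel
    | succ k =>
      change -LieAlgebra.ad K Q ((a ^ (k + 1)) (E b)) =
        a * -LieAlgebra.ad K Q ((a ^ k) (E b)) - -LieAlgebra.ad K Q ((a ^ k) (E b)) * a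
      ext u
      simp only [ha, pow_succ', Module.End.mul_apply, LieAlgebra.ad_apply, LinearMap.neg_apply,
        LinearMap.sub_apply, lie_neg, lie_lie]
      abel
  · change -LieAlgebra.ad K Q ((a ^ N) (E b)) = 0
    rw [ha, ad_pow_eq_zero_of_lowerCentralSeries_eq_bot hN b]
    simp

-- Only the term `k = 0`, which is `E (b - b')`, contributes to leading order; every other term
-- contains a further `ad` and lies one step deeper.
omit [CharZero K] in
theorem truncatedDexp_sub_mem (hN : lowerCentralSeries K Q Q N = ⊥) {b b' : Q} {m : ℕ}
    (h : b - b' ∈ lowerCentralSeries K Q Q m) :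
    truncatedDexp N E b - truncatedDexp N E b' - ((m : K) + 1) • (b - b') ∈
      lowerCentralSeries K Q Q (m + 1) := by
  -- For `N = 0` the truncated series is empty and has no leading term to split off, but then `Q` is
  -- zero.
  cases N with
  | zero =>
    have : ∀ u : Q, u = 0 := fun u => by
      rw [← LieSubmodule.mem_bot (R := K) (L := Q), ← hN]; simp
    rw [this (_ - _)]
    exact zero_mem _
  | succ N =>
    have : truncatedDexp (N + 1) E b - truncatedDexp (N + 1) E b' - ((m : K) + 1) • (b - b') =
        (∑ k ∈ range N, (((k + 2).factorial : K)⁻¹) •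
          (((LieAlgebra.ad K Q b ^ (k + 1)) (E b) - (LieAlgebra.ad K Q b' ^ (k + 1)) (E b)) +
            (LieAlgebra.ad K Q b' ^ (k + 1)) (E (b - b')))) +
          (E (b - b') - ((m : K) + 1) • (b - b')) := by
      simp only [truncatedDexp, sum_range_succ' _ N, map_sub, sub_add_sub_cancel]
      simp [smul_sub, sum_sub_distrib]
      abel
    rw [this]
    refine add_mem (sum_mem fun k _ => SMulMemClass.smul_mem _ (add_mem ?_ ?_))
      (hE.sub_smul_mem h)
    · exact LieModule.antitone_lowerCentralSeries K Q Q (by omega)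
        (ad_pow_sub_ad_pow_mem_lowerCentralSeries h (E b) (k + 1))
    · have hEb : E (b - b') ∈ lowerCentralSeries K Q Q m := by
        have := add_mem (LieModule.antitone_lowerCentralSeries K Q Q m.le_succ (hE.sub_smul_mem h))
          (SMulMemClass.smul_mem ((m : K) + 1) h)
        rwa [sub_add_cancel] at this
      exact LieModule.antitone_lowerCentralSeries K Q Q (by omega)
        (ad_pow_mem_lowerCentralSeries b' hEb (k + 1))

/-- Successive approximation along the filtration: at stage `m` the leading coefficient `m + 1` is
invertible, and the process stops at `N`. -/
theorem truncatedDexp_bijective (hN : lowerCentralSeries K Q Q N = ⊥) :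
    Function.Bijective (truncatedDexp N E) := by
  constructor
  · intro b b' h
    have hm : ∀ m, b - b' ∈ lowerCentralSeries K Q Q m := by
      intro m
      induction m with
      | zero => simp
      | succ m ih =>
        have := hE.truncatedDexp_sub_mem hN ih
        rw [h, sub_self, zero_sub, neg_mem_iff] at this
        exact (Submodule.smul_mem_iff _ (Nat.cast_add_one_ne_zero m)).1 this
    have := hm N
    rwa [hN, LieSubmodule.mem_bot, sub_eq_zero] at this
  · intro c
    have hm : ∀ m, ∃ b, c - truncatedDexp N E b ∈ lowerCentralSeries K Q Q m := by
      intro m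
      induction m with
      | zero => exact ⟨0, by simp⟩
      | succ m ih =>
        obtain ⟨b, hb⟩ := ih
        -- The correction is the current error divided by the leading coefficient, which cancels the
        -- error modulo the next term.
        refine ⟨b + ((m : K) + 1)⁻¹ • (c - truncatedDexp N E b), ?_⟩
        have := hE.truncatedDexp_sub_mem hN (b := b + ((m : K) + 1)⁻¹ • (c - truncatedDexp N E b))
          (b' := b) (m := m) (by rw [add_sub_cancel_left]; exact SMulMemClass.smul_mem _ hb)
        rw [add_sub_cancel_left, smul_inv_smul₀ (Nat.cast_add_one_ne_zero m), ← neg_mem_iff] at this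
        convert this using 1
        abel
    obtain ⟨b, hb⟩ := hm N
    rw [hN, LieSubmodule.mem_bot, sub_eq_zero] at hb
    exact ⟨b, hb.symm⟩

omit hE [CharZero K] in
theorem truncatedExp_ad_sub_mem (b : Q) {n : ℕ} {u : Q}
    (hN : lowerCentralSeries K Q Q N = ⊥) (hu : u ∈ lowerCentralSeries K Q Q n) :
    truncatedExp K N (LieAlgebra.ad K Q b) u - u ∈ lowerCentralSeries K Q Q (n + 1) := by
  cases N with
  | zero =>
    have : ∀ u : Q, u = 0 := fun u => by
      rw [← LieSubmodule.mem_bot (R := K) (L := Q), ← hN]; simp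
    rw [this (_ - _)]
    exact zero_mem _
  | succ N =>
    have : truncatedExp K (N + 1) (LieAlgebra.ad K Q b) u - u =
        ∑ k ∈ range N, (((k + 1).factorial : K)⁻¹) • (LieAlgebra.ad K Q b ^ (k + 1)) u := by
      simp [truncatedExp, sum_range_succ' _ N, LinearMap.sum_apply]
    rw [this]
    exact sum_mem fun k _ => SMulMemClass.smul_mem _
      (LieModule.antitone_lowerCentralSeries K Q Q (by omega)
        (ad_pow_mem_lowerCentralSeries b hu (k + 1)))

/-- The differential equation `[E, χ] = ad_c χ` has no solution which raises the filtration. -/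
theorem eq_zero_of_mul_eq (hN : lowerCentralSeries K Q Q N = ⊥) {c : Q} {χ : Module.End K Q}
    (hχ : E * χ = χ * E + LieAlgebra.ad K Q c * χ)
    (h1 : ∀ n, ∀ u ∈ lowerCentralSeries K Q Q n, χ u ∈ lowerCentralSeries K Q Q (n + 1)) :
    χ = 0 := by
  -- If `χ` raises the filtration by `k + 1`, then modulo one step more `E χ u` is `(n + k + 2) χ
  -- u`, `χ E u` is `(n + 1) χ u` and `ad_c χ u` vanishes. Hence `(k + 1) χ u` lies one step deeper.
  have key : ∀ k n, ∀ u ∈ lowerCentralSeries K Q Q n,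
      χ u ∈ lowerCentralSeries K Q Q (n + (k + 1)) := by
    intro k
    induction k with
    | zero => exact h1
    | succ k ih =>
      intro n u hu
      have e1 : E (χ u) = χ (E u) + ⁅c, χ u⁆ := LinearMap.congr_fun hχ u
      have e2 := hE.sub_smul_mem (ih n u hu)
      have e3 := ih _ _ (hE.sub_smul_mem hu)
      have e4 := lie_mem_lowerCentralSeries_succ c (ih n u hu)
      rw [show n + 1 + (k + 1) = n + (k + 1) + 1 by ring] at e3
      have := sub_mem (add_mem e3 e4) e2
      rw [e1, map_sub, map_smul] at this
      have e5 : χ (E u) - ((n : K) + 1) • χ u + ⁅c, χ u⁆ -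
          (χ (E u) + ⁅c, χ u⁆ - (((n + (k + 1) : ℕ) : K) + 1) • χ u) = ((k : K) + 1) • χ u := by
        push_cast
        module
      rw [e5] at this
      exact (Submodule.smul_mem_iff _ (Nat.cast_add_one_ne_zero k)).1 this
  ext u
  have := LieModule.antitone_lowerCentralSeries K Q Q (by omega : N ≤ 0 + (N + 1))
    (key N 0 u (by simp))
  rwa [hN, LieSubmodule.mem_bot] at this

omit hE [CharZero K] in
theorem truncatedDexp_of_map_eq_self (hN : lowerCentralSeries K Q Q N = ⊥) {x : Q}
    (hx : E x = x) : truncatedDexp N E x = x := by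
  cases N with
  | zero =>
    have : ∀ u : Q, u = 0 := fun u => by
      rw [← LieSubmodule.mem_bot (R := K) (L := Q), ← hN]; simp
    rw [this (truncatedDexp _ _ _), this x]
  | succ N => simp [truncatedDexp, sum_range_succ' _ N, hx, pow_succ]

-- The exponential of the derivation `ad x` acts as an automorphism; here this is conjugation of `ad
-- y` by `e^{ad_x}`.
omit hE in
theorem truncatedExp_ad_mul_ad (hN : lowerCentralSeries K Q Q N = ⊥) (x y : Q) :
    truncatedExp K N (LieAlgebra.ad K Q x) * LieAlgebra.ad K Q y =
      LieAlgebra.ad K Q (truncatedExp K N (LieAlgebra.ad K Q x) y) *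
        truncatedExp K N (LieAlgebra.ad K Q x) := by
  have key := truncatedExp_mul (K := K) (M := N) (ad_pow_eq_zero_of_lowerCentralSeries_eq_bot hN x)
    (fun k => LieAlgebra.ad K Q ((LieAlgebra.ad K Q x ^ k) y)) ?_ ?_
  · have hsum : LieAlgebra.ad K Q (truncatedExp K N (LieAlgebra.ad K Q x) y) =
        ∑ k ∈ range N, ((k.factorial : K)⁻¹) •
          LieAlgebra.ad K Q ((LieAlgebra.ad K Q x ^ k) y) := by
      simp only [truncatedExp, LinearMap.sum_apply, LinearMap.smul_apply, map_sum, map_smul]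
    rw [hsum]
    exact key
  · intro k
    ext u
    simp [pow_succ']
  · simp [ad_pow_eq_zero_of_lowerCentralSeries_eq_bot hN x]

/-- The Baker-Campbell-Hausdorff equation in a nilpotent Lie algebra follows from its logarithmic
derivative. -/
theorem truncatedExp_ad_eq_mul (hN : lowerCentralSeries K Q Q N = ⊥) {x y b : Q} (hx : E x = x)
    (hy : E y = y)
    (hb : truncatedDexp N E b = x + truncatedExp K N (LieAlgebra.ad K Q x) y) :
    truncatedExp K N (LieAlgebra.ad K Q b) =
      truncatedExp K N (LieAlgebra.ad K Q x) * truncatedExp K N (LieAlgebra.ad K Q y) := by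
  have h1 := hE.mul_truncatedExp_ad hN b
  have h2 := hE.mul_truncatedExp_ad hN x
  have h3 := hE.mul_truncatedExp_ad hN y
  have h4 := truncatedExp_ad_mul_ad hN x y
  rw [truncatedDexp_of_map_eq_self hN hx] at h2
  rw [truncatedDexp_of_map_eq_self hN hy] at h3
  rw [hb] at h1
  set c := x + truncatedExp K N (LieAlgebra.ad K Q x) y with hc
  rw [← sub_eq_zero]
  refine hE.eq_zero_of_mul_eq hN (c := c) ?_ ?_
  · rw [mul_sub, h1, ← mul_assoc, h2, add_mul, mul_assoc, h3, mul_add, ← mul_assoc, ← mul_assoc,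
      h4, hc, map_add]
    noncomm_ring
  · intro n u hu
    have f1 := truncatedExp_ad_sub_mem b hN hu
    have f2 := truncatedExp_ad_sub_mem y hN hu
    have f3 := truncatedExp_ad_sub_mem x hN
      (add_mem (LieModule.antitone_lowerCentralSeries K Q Q n.le_succ f2) hu)
    rw [sub_add_cancel] at f3
    have := sub_mem f1 (add_mem f3 f2)
    rwa [sub_add_sub_cancel, sub_sub_sub_cancel_right] at this

end IsDegreeDerivation

/-! ### The Dynkin map and the degree derivation of the free Lie algebra. -/

namespace FreeLieAlgebra

attribute [local instance 100] LieRing.ofAssociativeRing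

variable {K X : Type*} [CommRing K]

theorem mem_of_forall_of_mem (S : LieSubalgebra K (FreeLieAlgebra K X))
    (h : ∀ i, FreeLieAlgebra.of K i ∈ S) (u : FreeLieAlgebra K X) : u ∈ S := by
  have : S.incl.comp (lift K fun i => (⟨of K i, h i⟩ : S)) = LieHom.id := by
    ext i
    simp
  have hu := LieHom.congr_fun this u
  rw [LieHom.comp_apply, LieHom.id_apply] at hu
  rw [← hu]
  exact Subtype.property _

variable (K X) in
/-- The canonical map to the free associative algebra, whose elements are linear combinations of
words. -/
noncomputable def toWords : FreeLieAlgebra K X →ₗ⁅K⁆ MonoidAlgebra K (FreeMonoid X) :=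
  lift K fun i => MonoidAlgebra.of K _ (FreeMonoid.of i)

/-- The action of a generator in the representation which is used to define the Dynkin map. -/
noncomputable def dynkinGenerator (i : X) : Module.End K (K × FreeLieAlgebra K X) :=
  LinearMap.inr K K (FreeLieAlgebra K X) ∘ₗ
    (LinearMap.toSpanSingleton K _ (of K i)).coprod (LieAlgebra.ad K _ (of K i))

@[simp]
theorem dynkinGenerator_apply (i : X) (p : K × FreeLieAlgebra K X) :
    dynkinGenerator i p = (0, p.1 • of K i + ⁅of K i, p.2⁆) := by
  simp [dynkinGenerator]

variable (K X) in
/-- The representation of the free associative algebra on `K × FreeLieAlgebra K X` in which a word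
maps `(1, 0)` to the right-normed iterated bracket of its letters. -/
noncomputable def dynkinRep :
    MonoidAlgebra K (FreeMonoid X) →ₐ[K] Module.End K (K × FreeLieAlgebra K X) :=
  MonoidAlgebra.lift K _ _ (FreeMonoid.lift dynkinGenerator)

theorem dynkinRep_of (i : X) :
    dynkinRep K X (MonoidAlgebra.of K _ (FreeMonoid.of i)) = dynkinGenerator i := by
  rw [dynkinRep, MonoidAlgebra.lift_of, FreeMonoid.lift_eval_of]

theorem dynkinRep_toWords_of (i : X) :
    dynkinRep K X (toWords K X (of K i)) = dynkinGenerator i := by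
  rw [toWords, lift_of_apply, dynkinRep_of]

theorem dynkinRep_toWords_lie (u v : FreeLieAlgebra K X) (p : K × FreeLieAlgebra K X) :
    dynkinRep K X (toWords K X ⁅u, v⁆) p =
      dynkinRep K X (toWords K X u) (dynkinRep K X (toWords K X v) p) -
        dynkinRep K X (toWords K X v) (dynkinRep K X (toWords K X u) p) := by
  rw [LieHom.map_lie, LieRing.of_associative_ring_bracket, map_sub, map_mul, map_mul]
  rfl

/-- Both properties hold for generators and survive commutators, so Lie elements act on the second
factor by `ad`. This makes `degree` a derivation: apply the commutator of two such operators to `(1,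
0)`. -/
theorem dynkinRep_toWords (u : FreeLieAlgebra K X) :
    (∀ m, dynkinRep K X (toWords K X u) (0, m) = (0, ⁅u, m⁆)) ∧
      ∀ p, (dynkinRep K X (toWords K X u) p).1 = 0 := by
  let S : LieSubalgebra K (FreeLieAlgebra K X) :=
    { carrier := {u | (∀ m, dynkinRep K X (toWords K X u) (0, m) = (0, ⁅u, m⁆)) ∧
        ∀ p, (dynkinRep K X (toWords K X u) p).1 = 0}
      zero_mem' := by simp [Prod.mk_zero_zero]
      add_mem' := by
        rintro u v ⟨hu, hu'⟩ ⟨hv, hv'⟩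
        simp [hu, hv, hu', hv']
      smul_mem' := by
        rintro c u ⟨hu, hu'⟩
        simp [hu, hu']
      lie_mem' := by
        rintro u v ⟨hu, hu'⟩ ⟨hv, hv'⟩
        refine ⟨fun m => ?_, fun p => ?_⟩
        · rw [dynkinRep_toWords_lie, hv, hu, hu, hv, lie_lie]
          simp
        · rw [dynkinRep_toWords_lie, Prod.fst_sub, hu', hv', sub_zero] }
  refine mem_of_forall_of_mem S (fun i => ?_) u
  change _ ∧ _
  rw [dynkinRep_toWords_of]
  simp

variable (K X) in
/-- The Dynkin map, which maps a word to the right-normed iterated bracket of its letters. -/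
noncomputable def dynkin : MonoidAlgebra K (FreeMonoid X) →ₗ[K] FreeLieAlgebra K X :=
  LinearMap.snd K K _ ∘ₗ LinearMap.applyₗ (1, 0) ∘ₗ (dynkinRep K X).toLinearMap

theorem dynkin_apply (P : MonoidAlgebra K (FreeMonoid X)) :
    dynkin K X P = (dynkinRep K X P (1, 0)).2 := rfl

variable (K X) in
/-- The derivation which multiplies a bracket of `n` generators by `n`. -/
noncomputable def degree : FreeLieAlgebra K X →ₗ[K] FreeLieAlgebra K X :=
  dynkin K X ∘ₗ (toWords K X : FreeLieAlgebra K X →ₗ[K] MonoidAlgebra K (FreeMonoid X))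

theorem dynkinRep_toWords_one (u : FreeLieAlgebra K X) :
    dynkinRep K X (toWords K X u) (1, 0) = (0, degree K X u) :=
  Prod.ext ((dynkinRep_toWords u).2 _) rfl

theorem degree_of (i : X) : degree K X (of K i) = of K i := by
  have := dynkinRep_toWords_one (of K i)
  rw [dynkinRep_toWords_of] at this
  simpa using this.symm

theorem degree_lie (u v : FreeLieAlgebra K X) :
    degree K X ⁅u, v⁆ = ⁅degree K X u, v⁆ + ⁅u, degree K X v⁆ := by
  have := dynkinRep_toWords_lie u v (1, 0)
  simp only [dynkinRep_toWords_one, (dynkinRep_toWords _).1] at this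
  have := congrArg Prod.snd this
  rw [Prod.snd_sub, ← lie_skew v (degree K X u), sub_neg_eq_add, add_comm] at this
  exact this

theorem isDegreeDerivation_degree : IsDegreeDerivation (degree K X) where
  map_lie := degree_lie
  map_sub_self_mem := by
    let S : LieSubalgebra K (FreeLieAlgebra K X) :=
      { (lowerCentralSeries K (FreeLieAlgebra K X) (FreeLieAlgebra K X) 1).toSubmodule.comap
          (degree K X - LinearMap.id) with
        lie_mem' := by
          intro u v _ _
          have h : ∀ a b : FreeLieAlgebra K X, ⁅a, b⁆ ∈
              lowerCentralSeries K (FreeLieAlgebra K X) (FreeLieAlgebra K X) 1 :=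
            fun a b => lie_mem_lowerCentralSeries_succ a (by simp)
          change degree K X ⁅u, v⁆ - ⁅u, v⁆ ∈ lowerCentralSeries K _ _ 1
          rw [degree_lie]
          exact sub_mem (add_mem (h _ _) (h _ _)) (h _ _) }
    refine mem_of_forall_of_mem S fun i => ?_
    change degree K X (of K i) - of K i ∈ lowerCentralSeries K _ _ 1
    rw [degree_of, sub_self]
    exact zero_mem _

/-! ### Word length, and leading terms that commute with the generators. -/

/-- The linear combinations of words of length at least `n`. -/
def wordFiltration (K X : Type*) [CommRing K] (n : ℕ) :
    Submodule K (MonoidAlgebra K (FreeMonoid X)) where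
  carrier := {P | ∀ w, P.coeff w ≠ 0 → n ≤ w.length}
  zero_mem' := by simp
  add_mem' := by
    intro P R hP hR w hw
    by_contra h
    have h1 : P.coeff w = 0 := by_contra fun h' => h (hP w h')
    have h2 : R.coeff w = 0 := by_contra fun h' => h (hR w h')
    simp [h1, h2] at hw
  smul_mem' := by
    intro c P hP w hw
    refine hP w fun h => hw ?_
    simp [h]

theorem wordFiltration_antitone : Antitone (wordFiltration K X) :=
  fun _ _ h _ hP w hw => h.trans (hP w hw)

theorem mul_mem_wordFiltration {m n : ℕ} {P R : MonoidAlgebra K (FreeMonoid X)}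
    (hP : P ∈ wordFiltration K X m) (hR : R ∈ wordFiltration K X n) :
    P * R ∈ wordFiltration K X (m + n) := by
  classical
  intro w hw
  rw [MonoidAlgebra.coeff_mul] at hw
  obtain ⟨u, hu, hw⟩ := Finset.exists_ne_zero_of_sum_ne_zero hw
  obtain ⟨v, hv, hw⟩ := Finset.exists_ne_zero_of_sum_ne_zero hw
  obtain rfl : u * v = w := by_contra fun h => hw (if_neg h)
  rw [FreeMonoid.length_mul]
  exact add_le_add (hP u (Finsupp.mem_support_iff.1 hu)) (hR v (Finsupp.mem_support_iff.1 hv))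

theorem lie_mem_wordFiltration {m n : ℕ} {P R : MonoidAlgebra K (FreeMonoid X)}
    (hP : P ∈ wordFiltration K X m) (hR : R ∈ wordFiltration K X n) :
    ⁅P, R⁆ ∈ wordFiltration K X (m + n) := by
  rw [LieRing.of_associative_ring_bracket]
  exact sub_mem (mul_mem_wordFiltration hP hR)
    (add_comm n m ▸ mul_mem_wordFiltration hR hP)

theorem toWords_mem_wordFiltration {m : ℕ} {u : FreeLieAlgebra K X}
    (hu : u ∈ weightFiltration K X m) : toWords K X u ∈ wordFiltration K X (m + 1) := by
  have h1 : ∀ u, toWords K X u ∈ wordFiltration K X 1 := by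
    let S : LieSubalgebra K (FreeLieAlgebra K X) :=
      { (wordFiltration K X 1).comap
          (toWords K X : FreeLieAlgebra K X →ₗ[K] MonoidAlgebra K (FreeMonoid X)) with
        lie_mem' := by
          intro u v hu hv
          change toWords K X ⁅u, v⁆ ∈ wordFiltration K X 1
          rw [LieHom.map_lie]
          exact wordFiltration_antitone (by omega) (lie_mem_wordFiltration hu hv) }
    refine mem_of_forall_of_mem S fun i => ?_
    change toWords K X (of K i) ∈ wordFiltration K X 1
    rw [toWords, lift_of_apply]
    intro w hw
    rw [MonoidAlgebra.of_apply, MonoidAlgebra.coeff_single] at hw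
    obtain ⟨rfl, -⟩ := Finsupp.single_apply_ne_zero.1 hw
    exact le_rfl
  induction m generalizing u with
  | zero => exact h1 u
  | succ m ih =>
    refine lowerCentralSeries_succ_induction
      (p := fun u => toWords K X u ∈ wordFiltration K X (m + 1 + 1)) ?_ ?_ ?_ ?_ hu
    · rw [map_zero]; exact zero_mem _
    · intro u v h h'; rw [map_add]; exact add_mem h h'
    · intro c u h; rw [map_smul]; exact Submodule.smul_mem _ c h
    · intro a u hu
      rw [LieHom.map_lie]
      exact wordFiltration_antitone (by omega) (lie_mem_wordFiltration (h1 a) (ih hu))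

/-- A word of length `n + 1` is sent to an iterated bracket of `n + 1` letters. With
`toWords_mem_wordFiltration` this lets filtration estimates pass in both directions. -/
theorem dynkin_mem_weightFiltration {m : ℕ} {P : MonoidAlgebra K (FreeMonoid X)}
    (hP : P ∈ wordFiltration K X (m + 1)) : dynkin K X P ∈ weightFiltration K X m := by
  have key : ∀ (w : FreeMonoid X) (n : ℕ), w.length = n + 1 →
      ∃ u ∈ weightFiltration K X n,
        dynkinRep K X (MonoidAlgebra.of K _ w) (1, 0) = (0, u) := by
    intro w
    induction w using FreeMonoid.inductionOn' with
    | one => intro n h; simp at h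
    | of_mul i w ih =>
      intro n h
      rw [FreeMonoid.length_mul, FreeMonoid.length_of, add_comm, add_left_inj] at h
      cases n with
      | zero =>
        obtain rfl := FreeMonoid.length_eq_zero.1 h
        refine ⟨of K i, by simp, ?_⟩
        rw [mul_one, dynkinRep_of]
        simp
      | succ n =>
        obtain ⟨u, hu, hw⟩ := ih n h
        refine ⟨⁅of K i, u⁆, lie_mem_lowerCentralSeries_succ _ hu, ?_⟩
        rw [map_mul, map_mul, Module.End.mul_apply, hw, dynkinRep_of]
        simp
  have hPsum : P = ∑ w ∈ P.coeff.support, P.coeff w • MonoidAlgebra.of K _ w := by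
    classical
    ext w
    simp [Finsupp.finsetSum_apply, Finsupp.single_apply]
  rw [hPsum, map_sum]
  refine sum_mem fun w hw => ?_
  rw [map_smul]
  refine Submodule.smul_mem (weightFiltration K X m).toSubmodule _ ?_
  have hlen := hP w (Finsupp.mem_support_iff.1 hw)
  obtain ⟨u, hu, hwu⟩ := key w (w.length - 1) (by omega)
  rw [dynkin_apply, hwu]
  exact weightFiltration_antitone K X (by omega) hu

theorem mem_wordFiltration_succ [Nontrivial X] {m : ℕ} {P : MonoidAlgebra K (FreeMonoid X)}
    (hP : P ∈ wordFiltration K X (m + 1))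
    (h : ∀ i, ⁅P, MonoidAlgebra.of K _ (FreeMonoid.of i)⁆ ∈ wordFiltration K X (m + 3)) :
    P ∈ wordFiltration K X (m + 2) := by
  intro w hw
  by_contra hlt
  have hlen : w.length = m + 1 := le_antisymm (by omega) (hP w hw)
  obtain ⟨a, v, rfl⟩ : ∃ a v, w = v * FreeMonoid.of a := by
    rcases List.eq_nil_or_concat (FreeMonoid.toList w) with h | ⟨v, a, h⟩
    · change (FreeMonoid.toList w).length = _ at hlen
      rw [h] at hlen
      simp at hlen
    · exact ⟨a, FreeMonoid.ofList v, h.trans List.concat_eq_append⟩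
  -- As `w` ends in `a ≠ z`, the word `z w` does not end in `z`. Its coefficient in `P z - z P` is
  -- therefore minus that of `w` in `P`, and it vanishes because `z w` has length `m + 2`.
  obtain ⟨z, hz⟩ := exists_ne a
  have hc : ⁅P, MonoidAlgebra.of K _ (FreeMonoid.of z)⁆.coeff
      (FreeMonoid.of z * (v * FreeMonoid.of a)) = 0 := by
    by_contra hne
    have := h z _ hne
    rw [FreeMonoid.length_mul, FreeMonoid.length_of] at this
    omega
  rw [LieRing.of_associative_ring_bracket, MonoidAlgebra.coeff_sub, Finsupp.sub_apply,
    MonoidAlgebra.of_apply, MonoidAlgebra.coeff_single_mul_eq_mul_coeff (v * FreeMonoid.of a),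
    MonoidAlgebra.coeff_mul_single_of_forall_mul_ne, zero_sub, one_mul, neg_eq_zero] at hc
  · exact hw hc
  · intro d hd
    rw [← mul_assoc] at hd
    have := congrArg (fun w => (FreeMonoid.toList w).getLast?) hd
    simp only [FreeMonoid.toList_mul, FreeMonoid.toList_of, List.getLast?_concat,
      Option.some.injEq] at this
    exact hz this
  · intro b _
    exact mul_right_inj _

theorem mem_weightFiltration_succ {K X : Type*} [Field K] [CharZero K] [Nontrivial X] {m : ℕ}
    {u : FreeLieAlgebra K X} (hu : u ∈ weightFiltration K X m)
    (h : ∀ i, ⁅u, of K i⁆ ∈ weightFiltration K X (m + 2)) : u ∈ weightFiltration K X (m + 1) := by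
  have h1 : toWords K X u ∈ wordFiltration K X (m + 2) := by
    refine mem_wordFiltration_succ (toWords_mem_wordFiltration hu) fun i => ?_
    have := toWords_mem_wordFiltration (h i)
    rwa [LieHom.map_lie, toWords, lift_of_apply] at this
  have h2 : degree K X u ∈ weightFiltration K X (m + 1) := dynkin_mem_weightFiltration h1
  -- Modulo the next term `degree` is multiplication by `m + 1`, so knowing `degree K X u` there is
  -- enough; injectivity of `toWords` is not needed.
  have h3 := sub_mem h2 (isDegreeDerivation_degree.sub_smul_mem hu)
  rw [sub_sub_cancel] at h3
  exact (Submodule.smul_mem_iff (weightFiltration K X (m + 1)).toSubmodule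
    (Nat.cast_add_one_ne_zero m)).1 h3

end FreeLieAlgebra

/-! ### Naturality and stability of the truncated series. -/

section LieHom

variable {K Q Q' : Type*} [Field K] [LieRing Q] [LieAlgebra K Q] [LieRing Q']
  [LieAlgebra K Q']

theorem map_ad_pow (f : Q →ₗ⁅K⁆ Q') (a u : Q) (k : ℕ) :
    f ((LieAlgebra.ad K Q a ^ k) u) = (LieAlgebra.ad K Q' (f a) ^ k) (f u) := by
  induction k with
  | zero => rfl
  | succ k ih =>
    rw [pow_succ', pow_succ', Module.End.mul_apply, Module.End.mul_apply, LieAlgebra.ad_apply,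
      LieAlgebra.ad_apply, LieHom.map_lie, ih]

theorem map_truncatedDexp (f : Q →ₗ⁅K⁆ Q') {E : Q →ₗ[K] Q} {E' : Q' →ₗ[K] Q'}
    (h : ∀ u, f (E u) = E' (f u)) (N : ℕ) (b : Q) :
    f (truncatedDexp N E b) = truncatedDexp N E' (f b) := by
  simp only [truncatedDexp, map_sum, map_smul, map_ad_pow, h]

theorem truncatedDexp_eq_of_le {N M : ℕ} (hN : lowerCentralSeries K Q Q N = ⊥) (h : N ≤ M)
    (E : Q →ₗ[K] Q) (b : Q) : truncatedDexp M E b = truncatedDexp N E b := by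
  refine (sum_subset (range_mono h) fun k _ hk => ?_).symm
  rw [pow_eq_zero_of_le (by simpa using hk) (ad_pow_eq_zero_of_lowerCentralSeries_eq_bot hN b),
    LinearMap.zero_apply, smul_zero]

/-- The constant terms cancel and the linear ones give the bracket; from the quadratic term on, two
applications of `ad` gain two steps. The truncation `N + 2` ensures that the first two terms are
present. -/
theorem truncatedExp_ad_sub_sub_mem {b b' : Q} {m : ℕ}
    (h : b - b' ∈ lowerCentralSeries K Q Q m) (u : Q) (N : ℕ) :
    truncatedExp K (N + 2) (LieAlgebra.ad K Q b) u -
        truncatedExp K (N + 2) (LieAlgebra.ad K Q b') u - ⁅b - b', u⁆ ∈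
      lowerCentralSeries K Q Q (m + 2) := by
  have : truncatedExp K (N + 2) (LieAlgebra.ad K Q b) u -
        truncatedExp K (N + 2) (LieAlgebra.ad K Q b') u - ⁅b - b', u⁆ =
      ∑ k ∈ range N, (((k + 2).factorial : K)⁻¹) •
        ((LieAlgebra.ad K Q b ^ (k + 2)) u - (LieAlgebra.ad K Q b' ^ (k + 2)) u) := by
    simp only [truncatedExp, sum_range_succ' _ (N + 1), sum_range_succ' _ N, LinearMap.add_apply,
      LinearMap.sum_apply, LinearMap.smul_apply, smul_sub, sum_sub_distrib]
    simp
    abel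
  rw [this]
  exact sum_mem fun k _ => SMulMemClass.smul_mem _
    (LieModule.antitone_lowerCentralSeries K Q Q (by omega)
      (ad_pow_sub_ad_pow_mem_lowerCentralSeries h u (k + 2)))

theorem map_mem_lowerCentralSeries (f : Q →ₗ⁅K⁆ Q') {n : ℕ} {u : Q}
    (hu : u ∈ lowerCentralSeries K Q Q n) : f u ∈ lowerCentralSeries K Q' Q' n :=
  LieIdeal.map_lowerCentralSeries_le n (LieIdeal.mem_map hu)

theorem IsDegreeDerivation.of_surjective {f : Q →ₗ⁅K⁆ Q'} (hf : Function.Surjective f)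
    {E : Q →ₗ[K] Q} {E' : Q' →ₗ[K] Q'} (h : ∀ u, f (E u) = E' (f u))
    (hE : IsDegreeDerivation E) : IsDegreeDerivation E' where
  map_lie := by
    intro u v
    obtain ⟨u, rfl⟩ := hf u
    obtain ⟨v, rfl⟩ := hf v
    rw [← LieHom.map_lie, ← h, hE.map_lie, map_add, LieHom.map_lie, LieHom.map_lie, h, h]
  map_sub_self_mem := by
    intro u
    obtain ⟨u, rfl⟩ := hf u
    rw [← h, ← map_sub]
    exact map_mem_lowerCentralSeries f (hE.map_sub_self_mem u)

end LieHom

/-! ### The nilpotent quotients of the free Lie algebra. -/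

namespace FreeLieAlgebra

variable (K X : Type*) [Field K]

/-- The projection of the free Lie algebra to its quotient by a term of the weight filtration. -/
noncomputable def weightQuotientMk (n : ℕ) :
    FreeLieAlgebra K X →ₗ⁅K⁆ FreeLieAlgebra K X ⧸ weightFiltration K X n :=
  { (weightFiltration K X n).toSubmodule.mkQ with
    map_lie' := rfl }

theorem weightQuotientMk_surjective (n : ℕ) : Function.Surjective (weightQuotientMk K X n) :=
  Submodule.mkQ_surjective _

variable {K X} in
theorem weightQuotientMk_eq_zero {n : ℕ} {u : FreeLieAlgebra K X} :
    weightQuotientMk K X n u = 0 ↔ u ∈ weightFiltration K X n :=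
  LieSubmodule.Quotient.mk_eq_zero _

/-- The transition maps of the inverse system whose limit is the free complete Lie algebra. -/
noncomputable def weightQuotientFactor {m n : ℕ} (h : m ≤ n) :
    (FreeLieAlgebra K X ⧸ weightFiltration K X n) →ₗ⁅K⁆
      FreeLieAlgebra K X ⧸ weightFiltration K X m :=
  { Submodule.factor (weightFiltration_le K X h) with
    map_lie' := by
      intro u v
      obtain ⟨u, rfl⟩ := weightQuotientMk_surjective K X n u
      obtain ⟨v, rfl⟩ := weightQuotientMk_surjective K X n v
      rfl }

theorem lowerCentralSeries_weightQuotient (n : ℕ) :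
    lowerCentralSeries K (FreeLieAlgebra K X ⧸ weightFiltration K X n)
      (FreeLieAlgebra K X ⧸ weightFiltration K X n) n = ⊥ := by
  rw [← LieIdeal.lowerCentralSeries_map_eq n (weightQuotientMk_surjective K X n), eq_bot_iff,
    LieIdeal.map_le]
  rintro _ ⟨u, hu, rfl⟩
  exact weightQuotientMk_eq_zero.2 hu

/-- The degree derivation of the quotients of the free Lie algebra. -/
noncomputable def weightQuotientDegree (n : ℕ) :
    (FreeLieAlgebra K X ⧸ weightFiltration K X n) →ₗ[K]
      FreeLieAlgebra K X ⧸ weightFiltration K X n :=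
  (weightFiltration K X n).toSubmodule.mapQ _ (degree K X) fun u hu => by
    have := add_mem (LieModule.antitone_lowerCentralSeries K _ _ n.le_succ
      (isDegreeDerivation_degree.sub_smul_mem hu)) (SMulMemClass.smul_mem ((n : K) + 1) hu)
    rwa [sub_add_cancel] at this

theorem weightQuotientMk_degree (n : ℕ) (u : FreeLieAlgebra K X) :
    weightQuotientMk K X n (degree K X u) = weightQuotientDegree K X n (weightQuotientMk K X n u) :=
  rfl

theorem isDegreeDerivation_weightQuotientDegree (n : ℕ) :
    IsDegreeDerivation (weightQuotientDegree K X n) :=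
  isDegreeDerivation_degree.of_surjective (weightQuotientMk_surjective K X n)
    (weightQuotientMk_degree K X n)

theorem weightQuotientFactor_degree {m n : ℕ} (h : m ≤ n)
    (u : FreeLieAlgebra K X ⧸ weightFiltration K X n) :
    weightQuotientFactor K X h (weightQuotientDegree K X n u) =
      weightQuotientDegree K X m (weightQuotientFactor K X h u) := by
  obtain ⟨u, rfl⟩ := weightQuotientMk_surjective K X n u
  rfl

end FreeLieAlgebra

/-! ### Passage to the inverse limit. -/

namespace FreeCompleteLieAlgebra

open FreeLieAlgebra

variable {K X : Type*} [Field K]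

variable (K X) in
/-- The projections of the free complete Lie algebra. -/
noncomputable def proj (n : ℕ) :
    FreeCompleteLieAlgebra K X →ₗ⁅K⁆ FreeLieAlgebra K X ⧸ weightFiltration K X n where
  toFun f := f.1 n
  map_add' _ _ := rfl
  map_smul' _ _ := rfl
  map_lie' := rfl

theorem ext_proj {f g : FreeCompleteLieAlgebra K X} (h : ∀ n, proj K X n f = proj K X n g) :
    f = g :=
  Subtype.ext (funext h)

theorem proj_of (n : ℕ) (i : X) : proj K X n (of K i) = weightQuotientMk K X n (.of K i) := rfl

theorem weightQuotientFactor_proj {m n : ℕ} (h : m ≤ n) (f : FreeCompleteLieAlgebra K X) :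
    weightQuotientFactor K X h (proj K X n f) = proj K X m f :=
  f.2 m n h

theorem proj_expAd (n : ℕ) (a u : FreeCompleteLieAlgebra K X) :
    proj K X n (expAd a u) =
      truncatedExp K n (LieAlgebra.ad K _ (proj K X n a)) (proj K X n u) := by
  have h := tendsto_iff.1 (hasSum_expAd a u) n
  rw [SummationFilter.unconditional_filter] at h
  obtain ⟨s, hs, hns⟩ := (h.and (Filter.eventually_ge_atTop (range n))).exists
  change proj K X n _ = proj K X n _ at hs
  rw [← hs, map_sum, truncatedExp, LinearMap.sum_apply]
  simp only [map_smul, map_ad_pow, LinearMap.smul_apply]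
  refine (sum_subset hns fun k _ hk => ?_).symm
  rw [pow_eq_zero_of_le (by simpa using hk) (ad_pow_eq_zero_of_lowerCentralSeries_eq_bot
    (lowerCentralSeries_weightQuotient K X n) _), LinearMap.zero_apply, smul_zero]

variable [CharZero K]

theorem exists_expAd_eq_comp (i j : X) :
    ∃ b : FreeCompleteLieAlgebra K X, expAd b = expAd (of K i) ∘ expAd (of K j) := by
  set c : FreeCompleteLieAlgebra K X := of K i + expAd (of K i) (of K j) with hc
  have hE := isDegreeDerivation_weightQuotientDegree K X
  have hbij := fun n => (hE n).truncatedDexp_bijective (lowerCentralSeries_weightQuotient K X n)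
  choose b hb using fun n => (hbij n).surjective (proj K X n c)
  -- Both sides solve the level-`m` equation, whose solution is unique.
  have hcompat : ∀ m n (h : m ≤ n), weightQuotientFactor K X h (b n) = b m := by
    intro m n h
    refine (hbij m).injective ?_
    rw [hb, ← truncatedDexp_eq_of_le (lowerCentralSeries_weightQuotient K X m) h,
      ← map_truncatedDexp _ (weightQuotientFactor_degree K X h), hb, weightQuotientFactor_proj]
  refine ⟨⟨b, hcompat⟩, funext fun u => ext_proj fun n => ?_⟩
  rw [Function.comp_apply, proj_expAd, proj_expAd, proj_expAd, ← Module.End.mul_apply]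
  refine LinearMap.congr_fun ?_ _
  refine (hE n).truncatedExp_ad_eq_mul (lowerCentralSeries_weightQuotient K X n) ?_ ?_ ?_
  · rw [proj_of, ← weightQuotientMk_degree, degree_of]
  · rw [proj_of, ← weightQuotientMk_degree, degree_of]
  · rw [← proj_expAd, ← map_add, ← hc]
    exact hb n

theorem expAd_injective [Nontrivial X] :
    Function.Injective (expAd : FreeCompleteLieAlgebra K X → _) := by
  intro b b' h
  rw [← sub_eq_zero]
  refine ext_proj fun n => ?_
  rw [map_zero]
  induction n with
  | zero =>
    obtain ⟨u, hu⟩ := weightQuotientMk_surjective K X 0 (proj K X 0 (b - b'))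
    rw [← hu]
    exact weightQuotientMk_eq_zero.2 (LieSubmodule.mem_top u)
  | succ n ih =>
    -- Level `n + 2` is needed to conclude at level `n + 1`: bracketing with a generator raises the
    -- weight by one, and the error in the linear approximation vanishes exactly there.
    obtain ⟨u, hu⟩ := weightQuotientMk_surjective K X (n + 2) (proj K X (n + 2) (b - b'))
    have hu' : ∀ m (hm : m ≤ n + 2), weightQuotientMk K X m u = proj K X m (b - b') := by
      intro m hm
      rw [← weightQuotientFactor_proj hm, ← hu]
      rfl
    have hun : u ∈ weightFiltration K X n := by
      rw [← weightQuotientMk_eq_zero, hu' n (by omega), ih]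
    rw [← hu' (n + 1) (by omega), weightQuotientMk_eq_zero]
    refine mem_weightFiltration_succ hun fun i => ?_
    have hmem := map_mem_lowerCentralSeries (weightQuotientMk K X (n + 2)) hun
    rw [hu, map_sub] at hmem
    have key := truncatedExp_ad_sub_sub_mem hmem (proj K X (n + 2) (of K i)) n
    rw [← proj_expAd, ← proj_expAd, h, sub_self, zero_sub, lowerCentralSeries_weightQuotient,
      LieSubmodule.mem_bot, neg_eq_zero, ← map_sub, ← hu, proj_of, ← LieHom.map_lie] at key
    exact weightQuotientMk_eq_zero.1 key

end FreeCompleteLieAlgebra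

theorem mainTheorem8 (K : Type*) [Field K] [CharZero K] :
    ∃! b : FreeCompleteLieAlgebra K (Fin 2),
      FreeCompleteLieAlgebra.expAd b =
        FreeCompleteLieAlgebra.expAd (FreeCompleteLieAlgebra.of K 0) ∘
          FreeCompleteLieAlgebra.expAd (FreeCompleteLieAlgebra.of K 1) := by
  obtain ⟨b, hb⟩ := FreeCompleteLieAlgebra.exists_expAd_eq_comp (K := K) (0 : Fin 2) 1
  exact ⟨b, hb, fun b' hb' => FreeCompleteLieAlgebra.expAd_injective (hb'.trans hb.symm)⟩
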